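/- Let $\mathbb D\subset\mathbb C$ be the open unit disc. For a domain $D\subset\mathbb C^n$ and $z,w\in D$ put $$c_D(z,w)=\sup\{\tanh^{-1}|f(w)| : f\in\mathcal O(D,\mathbb D),\ f(z)=0\},$$ $$\tilde k_D(z,w)=\inf\{\tanh^{-1}|\alpha| : \alpha\in\mathbb D,\ \exists\,\varphi\in\mathcal O(\mathbb D,D),\ \varphi(0)=z,\ \varphi(\alpha)=w\},$$ $$k_D^{(m)}(z,w)=\inf\Big\{\sum_{j=1}^m\tilde k_D(z_{j-1},z_j) : z_0,\dots,z_m\in D,\ z_0=z,\ z_m=w\Big\}\qquad(m\in\mathbb N),$$ where $\mathcal O(X,Y)$ is the set of holomorphic maps from $X$ to $Y$; put $l^*=\tanh l$ for each such function $l$. For a balanced domain $D$ (that is, $\lambda z\in D$ whenever $z\in D$, $|\lambda|\le 1$), let $h_D(z)=\inf\{t>0: z/t\in D\}$ be its Minkowski function, and let $\widehat h_D$ be the Minkowski function of the convex hull of $D$. Let $$D=\{(z_1,z_2)\in\mathbb C^2 : |z_1|<1,\ |z_1^{34}z_2^{55}|<1\}.$$ Then $D$ is an unbounded pseudoconvex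 balanced Reinhardt domain whose Minkowski function $h_D$ is continuous, and there is a point $a\in D$ with $\widehat h_D(a)>0$ such that: 1. $\partial D$ contains a nontrivial analytic disc through $a/h_D(a)$, i.e. there is a nonconstant holomorphic map $\varphi:\mathbb D\to\mathbb C^2$ with $\varphi(\mathbb D)\subset\partial D$ and $a/h_D(a)\in\varphi(\mathbb D)$; 2. $(k_D^{(2)}(0,\lambda a))^*=|\lambda|\,\widehat h_D(a)$ for all $\lambda\in\mathbb C$ with $|\lambda|\le 1$; 3. $c_D^*(0,\lambda a)>|\lambda|\,\widehat h_D(a)$ for all $\lambda\in\mathbb C$ with $1<|\lambda|<1/h_D(a)$. -/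

import Mathlib

open Set Metric
open scoped ENNReal

noncomputable section

namespace InvariantFunctions

section General

variable {E : Type*} [NormedAddCommGroup E] [NormedSpace ℂ E]

/-- A domain: a nonempty connected open set. -/
def IsDomainSet (D : Set E) : Prop :=
  IsOpen D ∧ IsConnected D

/-- The Carathéodory pseudodistance of `D`, as the supremum of `artanh |f w|` over all holomorphic
`f : D → 𝔻` with `f z = 0`. It takes values in `[0, ∞]`, so the supremum is always meaningful. -/
def caratheodory (D : Set E) (z w : E) : ℝ≥0∞ :=
  ⨆ (f : E → ℂ) (_ : DifferentiableOn ℂ f D ∧ MapsTo f D (ball 0 1) ∧ f z = 0),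
    ENNReal.ofReal (Real.artanh ‖f w‖)

/-- The Lempert function of `D`, as the infimum of `artanh |α|` over all `α` in the unit disc for
which some holomorphic `φ : 𝔻 → D` has `φ 0 = z` and `φ α = w`
(it is `∞` if there is no such disc). -/
def lempert (D : Set E) (z w : E) : ℝ≥0∞ :=
  ⨅ (α : ℂ) (_ : α ∈ ball (0 : ℂ) 1 ∧ ∃ φ : ℂ → E, DifferentiableOn ℂ φ (ball 0 1) ∧
      MapsTo φ (ball 0 1) D ∧ φ 0 = z ∧ φ α = w),
    ENNReal.ofReal (Real.artanh ‖α‖)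

/-- The `m`-th Lempert function of `D`: the infimum of `∑ j, lempert D (p (j-1)) (p j)` over all
chains `p 0, …, p m` of points of `D` from `z` to `w`. -/
def lempertChain (m : ℕ) (D : Set E) (z w : E) : ℝ≥0∞ :=
  ⨅ (p : Fin (m + 1) → E) (_ : (∀ j, p j ∈ D) ∧ p 0 = z ∧ p (Fin.last m) = w),
    ∑ j : Fin m, lempert D (p j.castSucc) (p j.succ)

/-- The operation `l ↦ l* = tanh l` on `[0, ∞]`, with `tanh ∞ = 1`. -/
def tanhStar (x : ℝ≥0∞) : ℝ :=
  if x = ⊤ then 1 else Real.tanh x.toReal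

/-- Continuous plurisubharmonic functions `u : D → ℝ`: `u` satisfies the sub-mean value inequality
on every closed complex affine disc `{a + ζ b : |ζ| ≤ 1}` contained in `D`. (All the circle
averages exist, as `u` is continuous.) -/
def ContinuousPlurisubharmonicOn (u : E → ℝ) (D : Set E) : Prop :=
  ContinuousOn u D ∧
    ∀ a b : E, (∀ ζ : ℂ, ‖ζ‖ ≤ 1 → a + ζ • b ∈ D) →
      u a ≤ Real.circleAverage (fun ζ : ℂ => u (a + ζ • b)) 0 1

/-- A pseudoconvex open set: it has a continuous plurisubharmonic exhaustion function. -/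
def IsPseudoconvex (D : Set E) : Prop :=
  IsOpen D ∧ ∃ u : E → ℝ, ContinuousPlurisubharmonicOn u D ∧
    ∀ c : ℝ, IsCompact {z | z ∈ D ∧ u z ≤ c}

/-- The set `S` contains a nontrivial analytic disc through `b`: there is a nonconstant holomorphic
map from the unit disc with image in `S` and with `b` in its image. -/
def HasNontrivialDiscThrough (S : Set E) (b : E) : Prop :=
  ∃ φ : ℂ → E, DifferentiableOn ℂ φ (ball 0 1) ∧ MapsTo φ (ball 0 1) S ∧
    b ∈ φ '' ball 0 1 ∧ ∃ ζ ∈ ball (0 : ℂ) 1, ∃ ξ ∈ ball (0 : ℂ) 1, φ ζ ≠ φ ξ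

end General

/-- Reinhardt sets: invariant under rotation of each coordinate. -/
def IsReinhardt {n : ℕ} (D : Set (Fin n → ℂ)) : Prop :=
  ∀ z ∈ D, ∀ ω : Fin n → ℂ, (∀ j, ‖ω j‖ = 1) → (fun j => ω j * z j) ∈ D

/-- The set `{|z₁| < 1, |z₁^34 z₂^55| < 1}` in `ℂ²`. -/
def exampleDomain : Set (Fin 2 → ℂ) :=
  {z | ‖z 0‖ < 1 ∧ ‖z 0 ^ 34 * z 1 ^ 55‖ < 1}

end InvariantFunctions

end

/-! Only the first coordinate is seen by the convex hull: `exampleDomain` contains the line `z 0 =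
0`, so its hull is `{‖z 0‖ < 1}`, with Minkowski function `‖z 0‖`. Take `a = (2⁻⁸⁹, 1)`.

For `‖q 1‖ ≤ 1` the second Lempert function is the Poincaré distance of `q 0` from `0`. Projection
to `z 0` and Schwarz–Pick give the lower bound (`artanh_norm_le_lempertChain_two`). The chain `0 →
(0, q 1) → q` attains it: its first step is free along a complex line, its second lies on a
horizontal disc (`lempertChain_two_zero_le`). For `q = λa` the condition is `|λ| ≤ 1`.

For `|λ| > 1` the competitor `z 0 * z 1`, which is bounded by `1` on the domain, is quadratic in
`λ`: its modulus at `λa` is `|λ|² 2⁻⁸⁹ > |λ| 2⁻⁸⁹`.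

The boundary disc lies in a level set of `z 0 ^ 34 * z 1 ^ 55`. -/

open Set Metric Filter Topology
open scoped ENNReal

namespace InvariantFunctions

/-! ### Tools: sub-mean values, gauges, Schwarz–Pick, chains -/

section Auxiliary

variable {E : Type*} [NormedAddCommGroup E] [NormedSpace ℂ E]

/-- A function on the circle that dominates the real part of an entire function has circle average
at least the value of that real part at the centre. -/
lemma le_circleAverage_of_re_le {v : ℂ → ℝ} (hv : CircleIntegrable v 0 1) {F : ℂ → ℂ}
    (hF : Differentiable ℂ F) (h : ∀ ζ ∈ sphere (0 : ℂ) 1, (F ζ).re ≤ v ζ) :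
    (F 0).re ≤ Real.circleAverage v 0 1 := by
  have hm : Real.circleAverage (fun ζ => (F ζ).re) 0 1 = (F 0).re :=
    InnerProductSpace.HarmonicOnNhd.circleAverage_eq
      (fun z _ => (hF.analyticAt z).harmonicAt_re)
  rw [← hm]
  refine Real.circleAverage_mono ?_ hv (by simpa using h)
  exact (Complex.continuous_re.comp hF.continuous).continuousOn.circleIntegrable zero_le_one

lemma exists_unimodular_mul_eq_norm (w : ℂ) : ∃ ω : ℂ, ‖ω‖ = 1 ∧ ω * w = ‖w‖ := by
  by_cases hw : w = 0
  · exact ⟨1, by simp, by simp [hw]⟩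
  · have hn : (‖w‖ : ℂ) ≠ 0 := by simpa using hw
    refine ⟨‖w‖ / w, by simp [hw], by field_simp⟩

/-- `‖G‖` dominates the real part of an entire function that agrees with it at `0`. -/
lemma exists_entire_re_le_norm {G : ℂ → ℂ} (hG : Differentiable ℂ G) :
    ∃ F : ℂ → ℂ, Differentiable ℂ F ∧ (F 0).re = ‖G 0‖ ∧ ∀ ζ, (F ζ).re ≤ ‖G ζ‖ := by
  obtain ⟨ω, hω, hω'⟩ := exists_unimodular_mul_eq_norm (G 0)
  refine ⟨fun ζ => ω * G ζ, hG.const_mul ω, by simp [hω'], fun ζ => ?_⟩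
  simpa [hω] using Complex.re_le_norm (ω * G ζ)

/-- Convexity: the graph of `x ↦ (1 - x)⁻¹` lies above its tangent at `c`. The tangent is affine, so
it turns real parts of entire functions into real parts of entire functions. -/
lemma inv_one_sub_tangent_le {c x : ℝ} (hc : c < 1) (hx : x < 1) :
    (1 - c)⁻¹ + ((1 - c) ^ 2)⁻¹ * (x - c) ≤ (1 - x)⁻¹ := by
  have h1 : 0 < 1 - c := by linarith
  have h2 : 0 < 1 - x := by linarith
  have : (1 - x)⁻¹ - ((1 - c)⁻¹ + ((1 - c) ^ 2)⁻¹ * (x - c)) =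
      (x - c) ^ 2 / ((1 - x) * (1 - c) ^ 2) := by
    field_simp
    ring
  have h3 : 0 ≤ (x - c) ^ 2 / ((1 - x) * (1 - c) ^ 2) := by positivity
  linarith

/-- `(1 - ‖G‖)⁻¹` dominates, where `‖G‖ < 1`, the real part of an entire function that agrees with
it at `0`. -/
lemma exists_entire_re_le_inv_one_sub_norm {G : ℂ → ℂ} (hG : Differentiable ℂ G)
    (h0 : ‖G 0‖ < 1) :
    ∃ F : ℂ → ℂ, Differentiable ℂ F ∧ (F 0).re = (1 - ‖G 0‖)⁻¹ ∧
      ∀ ζ, ‖G ζ‖ < 1 → (F ζ).re ≤ (1 - ‖G ζ‖)⁻¹ := by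
  obtain ⟨F, hF, hF0, hFle⟩ := exists_entire_re_le_norm hG
  set c : ℝ := ‖G 0‖
  have key : ∀ ζ, ((((1 - c)⁻¹ : ℝ) : ℂ) + ((((1 - c) ^ 2)⁻¹ : ℝ) : ℂ) * (F ζ - (c : ℂ))).re =
      (1 - c)⁻¹ + ((1 - c) ^ 2)⁻¹ * ((F ζ).re - c) := fun ζ => by
    rw [Complex.add_re, Complex.re_ofReal_mul, Complex.sub_re, Complex.ofReal_re,
      Complex.ofReal_re]
  refine ⟨fun ζ => (((1 - c)⁻¹ : ℝ) : ℂ) + ((((1 - c) ^ 2)⁻¹ : ℝ) : ℂ) * (F ζ - (c : ℂ)),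
    ((hF.sub_const _).const_mul _).const_add _, ?_, fun ζ hζ => ?_⟩
  · rw [key, hF0]
    simp
  · rw [key]
    refine le_trans ?_ (inv_one_sub_tangent_le h0 hζ)
    have := hFle ζ
    gcongr

/-- The Minkowski function, read off from the set of positive scalings that bring `x` into `s`. -/
lemma gauge_eq_of_forall_inv_smul_mem_iff {V : Type*} [AddCommGroup V] [Module ℝ V] {s : Set V}
    {x : V} {M : ℝ} (hM : 0 ≤ M) (h : ∀ r : ℝ, 0 < r → (r⁻¹ • x ∈ s ↔ M < r)) :
    gauge s x = M := by
  have : {r ∈ Set.Ioi (0 : ℝ) | r⁻¹ • x ∈ s} = Set.Ioi M := by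
    ext r
    constructor
    · rintro ⟨h0, h1⟩
      exact (h r h0).1 h1
    · intro hr
      have h0 : 0 < r := hM.trans_lt hr
      exact ⟨h0, (h r h0).2 hr⟩
  rw [gauge_def', this, csInf_Ioi]

lemma tanhStar_ofReal_artanh {r : ℝ} (h0 : 0 ≤ r) (h1 : r < 1) :
    tanhStar (ENNReal.ofReal (Real.artanh r)) = r := by
  rw [tanhStar, if_neg ENNReal.ofReal_ne_top, ENNReal.toReal_ofReal (Real.artanh_nonneg h0),
    Real.tanh_artanh ⟨by linarith, h1⟩]

lemma le_tanhStar_of_ofReal_artanh_le {r : ℝ} (h1 : r < 1) {x : ℝ≥0∞}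
    (h : ENNReal.ofReal (Real.artanh r) ≤ x) : r ≤ tanhStar x := by
  rw [tanhStar]
  split_ifs with hx
  · exact h1.le
  · by_contra! hlt
    have := Real.artanh_lt_artanh (Real.neg_one_lt_tanh _) h1 hlt
    rw [Real.artanh_tanh] at this
    exact this.not_ge ((ENNReal.ofReal_le_iff_le_toReal hx).1 h)

/-- The addition formula for `artanh`, with `z ≤ (x + y) / (1 + x * y)` cleared of its denominator.
-/
lemma artanh_le_add {x y z : ℝ} (hx : 0 ≤ x) (hx1 : x < 1) (hy : 0 ≤ y) (hy1 : y < 1)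
    (hz : 0 ≤ z) (hz1 : z < 1) (h : z * (1 + x * y) ≤ x + y) :
    Real.artanh z ≤ Real.artanh x + Real.artanh y := by
  have e : ∀ w : ℝ, 0 ≤ w → w < 1 → Real.artanh w = 1 / 2 * Real.log ((1 + w) / (1 - w)) :=
    fun w h0 h1 => Real.artanh_eq_half_log ⟨by linarith, h1.le⟩
  have p : ∀ w : ℝ, 0 ≤ w → w < 1 → 0 < (1 + w) / (1 - w) :=
    fun w h0 h1 => div_pos (by linarith) (by linarith)
  rw [e x hx hx1, e y hy hy1, e z hz hz1, ← mul_add,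
    ← Real.log_mul (p x hx hx1).ne' (p y hy hy1).ne']
  refine mul_le_mul_of_nonneg_left (Real.log_le_log (p z hz hz1) ?_) (by norm_num)
  rw [div_mul_div_comm, div_le_div_iff₀ (by linarith)
    (mul_pos (by linarith) (by linarith))]
  linarith

lemma normSq_one_sub_conj_mul (u w : ℂ) :
    ‖1 - (starRingEnd ℂ) u * w‖ ^ 2 - ‖w - u‖ ^ 2 = (1 - ‖u‖ ^ 2) * (1 - ‖w‖ ^ 2) := by
  simp only [← Complex.normSq_eq_norm_sq, Complex.normSq_apply]
  simp
  ring

/-- Schwarz–Pick: a holomorphic self-map `f` of the disc does not increase the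
pseudohyperbolic distance from `0`. -/
lemma norm_sub_le_of_mapsTo_unitBall {f : ℂ → ℂ} (hf : DifferentiableOn ℂ f (ball 0 1))
    (hm : MapsTo f (ball 0 1) (ball 0 1)) {α : ℂ} (hα : ‖α‖ < 1) :
    ‖f α - f 0‖ ≤ ‖α‖ * ‖1 - (starRingEnd ℂ) (f 0) * f α‖ := by
  set u := f 0
  have hu : ‖u‖ < 1 := by simpa using hm (mem_ball_self one_pos)
  have hlt : ∀ w : ℂ, ‖w‖ < 1 → ‖w - u‖ < ‖1 - (starRingEnd ℂ) u * w‖ := fun w hw => by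
    have h := normSq_one_sub_conj_mul u w
    have : 0 < (1 - ‖u‖ ^ 2) * (1 - ‖w‖ ^ 2) := by
      have := norm_nonneg u
      have := norm_nonneg w
      apply mul_pos <;> nlinarith
    exact lt_of_pow_lt_pow_left₀ 2 (norm_nonneg _) (by linarith)
  have hpos : ∀ w : ℂ, ‖w‖ < 1 → 0 < ‖1 - (starRingEnd ℂ) u * w‖ :=
    fun w hw => (norm_nonneg _).trans_lt (hlt w hw)
  have hfn : ∀ ζ ∈ ball (0 : ℂ) 1, ‖f ζ‖ < 1 := fun ζ hζ => by simpa using hm hζ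
  have hαb : α ∈ ball (0 : ℂ) 1 := by simpa using hα
  -- Schwarz's lemma for `f` followed by the disc automorphism that sends `f 0` to `0`.
  have := Complex.norm_le_norm_of_mapsTo_ball (z := α) (R := 1)
    (f := fun ζ => (f ζ - u) / (1 - (starRingEnd ℂ) u * f ζ))
    ((hf.sub_const u).div ((hf.const_mul _).const_sub 1)
      fun ζ hζ => norm_pos_iff.1 (hpos _ (hfn ζ hζ)))
    (fun ζ hζ => by
      rw [mem_closedBall_zero_iff, norm_div]
      exact div_le_one_of_le₀ (hlt _ (hfn ζ hζ)).le (norm_nonneg _))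
    (by simp [u]) hα
  rwa [norm_div, div_le_iff₀ (hpos _ (hfn α hαb))] at this

/-- Schwarz–Pick in terms of moduli alone, in the form that `artanh_le_add` consumes. -/
lemma norm_mul_one_add_le_of_mapsTo_unitBall {f : ℂ → ℂ} (hf : DifferentiableOn ℂ f (ball 0 1))
    (hm : MapsTo f (ball 0 1) (ball 0 1)) {α : ℂ} (hα : ‖α‖ < 1) :
    ‖f α‖ * (1 + ‖f 0‖ * ‖α‖) ≤ ‖f 0‖ + ‖α‖ := by
  have h := norm_sub_le_of_mapsTo_unitBall hf hm hα
  have hu : ‖f 0‖ < 1 := by simpa using hm (mem_ball_self one_pos)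
  have hv : ‖f α‖ < 1 := by simpa using hm (show α ∈ ball (0 : ℂ) 1 by simpa using hα)
  have hid := normSq_one_sub_conj_mul (f 0) (f α)
  have htri := norm_sub_norm_le (f α) (f 0)
  set x := ‖f 0‖
  set y := ‖f α‖
  set s := ‖α‖
  set A := ‖f α - f 0‖
  set B := ‖1 - (starRingEnd ℂ) (f 0) * f α‖
  have hx0 : 0 ≤ x := norm_nonneg _
  have hy0 : 0 ≤ y := norm_nonneg _
  have hs0 : 0 ≤ s := norm_nonneg _
  have hA0 : 0 ≤ A := norm_nonneg _
  have hB0 : 0 ≤ B := norm_nonneg _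
  rcases le_or_gt y x with hyx | hyx
  · nlinarith [mul_nonneg hx0 hs0, mul_le_mul hv.le hu.le hx0 zero_le_one,
      mul_nonneg hs0 (mul_nonneg hx0 hy0), mul_le_mul_of_nonneg_left
        (mul_le_mul hv.le hu.le hx0 zero_le_one) hs0]
  · have h2 : A ^ 2 ≤ s ^ 2 * B ^ 2 := by
      rw [← mul_pow]
      exact pow_le_pow_left₀ hA0 h 2
    have h3 : (y - x) ^ 2 ≤ A ^ 2 := pow_le_pow_left₀ (by linarith) htri 2
    have h4 : (y - x) ^ 2 * (1 - s ^ 2) ≤ s ^ 2 * ((1 - x ^ 2) * (1 - y ^ 2)) := by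
      have : (y - x) ^ 2 * (1 - s ^ 2) ≤ A ^ 2 * (1 - s ^ 2) :=
        mul_le_mul_of_nonneg_right h3 (by nlinarith)
      nlinarith
    -- Uses `(1 - x²)(1 - y²) = (1 - xy)² - (y - x)²`.
    have h5 : (y - x) ^ 2 ≤ (s * (1 - x * y)) ^ 2 := by nlinarith
    have h6 := le_of_sq_le_sq h5 (mul_nonneg hs0 (by nlinarith))
    linarith

/-- Two-step chains, as an infimum over the intermediate point. -/
lemma le_lempertChain_two {D : Set E} {z w : E} {c : ℝ≥0∞}
    (h : ∀ p ∈ D, c ≤ lempert D z p + lempert D p w) : c ≤ lempertChain 2 D z w := by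
  refine le_iInf₂ fun p hp => ?_
  obtain ⟨hD, h0, h2⟩ := hp
  have := h (p 1) (hD 1)
  rw [Fin.sum_univ_two]
  subst h0 h2
  exact this

lemma lempertChain_two_le {D : Set E} {z w p : E} (hz : z ∈ D) (hp : p ∈ D) (hw : w ∈ D) :
    lempertChain 2 D z w ≤ lempert D z p + lempert D p w := by
  refine (iInf₂_le ![z, p, w] ⟨?_, rfl, rfl⟩).trans ?_
  · rw [Fin.sum_univ_two]
    rfl
  · intro j
    fin_cases j <;> assumption

lemma lempert_le {D : Set E} {φ : ℂ → E} (hφ : DifferentiableOn ℂ φ (ball 0 1))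
    (hm : MapsTo φ (ball 0 1) D) {α : ℂ} (hα : ‖α‖ < 1) :
    lempert D (φ 0) (φ α) ≤ ENNReal.ofReal (Real.artanh ‖α‖) :=
  iInf₂_le α ⟨by simpa using hα, φ, hφ, hm, rfl, rfl⟩

/-- The Lempert function vanishes between two points of a complex line contained in `D`. -/
lemma lempert_zero_eq_zero_of_line {D : Set E} {v : E} (h : ∀ s : ℂ, s • v ∈ D) :
    lempert D 0 v = 0 := by
  have key : ∀ ε : ℝ, 0 < ε → ε < 1 → lempert D 0 v ≤ ENNReal.ofReal (Real.artanh ε) := by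
    intro ε h0 h1
    have hε : (ε : ℂ) ≠ 0 := by exact_mod_cast h0.ne'
    have hn : ‖(ε : ℂ)‖ = ε := by simp [abs_of_pos h0]
    -- The whole line is available, so the disc can be stretched to reach `v` already at parameter
    -- `ε`.
    have := lempert_le (D := D) (φ := fun ζ : ℂ => (ζ / (ε : ℂ)) • v) (α := (ε : ℂ))
      (by fun_prop) (fun ζ _ => h _) (by rwa [hn])
    simpa [hε, hn, abs_of_pos h0] using this
  have hcont : Tendsto (fun ε : ℝ => ENNReal.ofReal (Real.artanh ε)) (𝓝[>] 0) (𝓝 0) := by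
    have hc : ContinuousAt Real.artanh 0 := by
      unfold Real.artanh
      have : ContinuousAt (fun x : ℝ => √((1 + x) / (1 - x))) 0 :=
        ((continuousAt_const.add continuousAt_id).div
          (continuousAt_const.sub continuousAt_id) (by simp)).sqrt
      exact this.log (by simp)
    have := (ENNReal.continuous_ofReal.continuousAt.comp hc).tendsto
    simp only [Function.comp_def, Real.artanh_zero, ENNReal.ofReal_zero] at this
    exact this.mono_left nhdsWithin_le_nhds
  refine le_antisymm (ge_of_tendsto hcont ?_) zero_le
  filter_upwards [Ioo_mem_nhdsGT (zero_lt_one' ℝ)] with ε hε using key ε hε.1 hε.2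

end Auxiliary

/-! ### Elementary geometry of the domain -/

section Example

lemma mem_exampleDomain_iff {z : Fin 2 → ℂ} :
    z ∈ exampleDomain ↔ ‖z 0‖ < 1 ∧ ‖z 0 ^ 34 * z 1 ^ 55‖ < 1 := Iff.rfl

lemma isOpen_exampleDomain : IsOpen exampleDomain := by
  exact (isOpen_lt (f := fun z : Fin 2 → ℂ => ‖z 0‖) (by fun_prop) continuous_const).inter
    (isOpen_lt (f := fun z : Fin 2 → ℂ => ‖z 0 ^ 34 * z 1 ^ 55‖) (by fun_prop) continuous_const)

lemma balanced_exampleDomain : Balanced ℂ exampleDomain := by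
  refine balanced_iff_smul_mem.2 fun c hc z hz => ?_
  refine ⟨?_, ?_⟩
  · have := norm_nonneg (z 0)
    simp only [Pi.smul_apply, smul_eq_mul, norm_mul]
    nlinarith [hz.1, norm_nonneg c]
  · have h : (c • z) 0 ^ 34 * (c • z) 1 ^ 55 = c ^ 89 * (z 0 ^ 34 * z 1 ^ 55) := by
      simp only [Pi.smul_apply, smul_eq_mul]
      ring
    rw [h, norm_mul, norm_pow]
    exact (mul_le_of_le_one_left (norm_nonneg _) (pow_le_one₀ (norm_nonneg _) hc)).trans_lt hz.2

lemma line_subset_exampleDomain (w : ℂ) : (![0, w] : Fin 2 → ℂ) ∈ exampleDomain := by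
  simp [mem_exampleDomain_iff]

lemma zero_mem_exampleDomain : (0 : Fin 2 → ℂ) ∈ exampleDomain := by
  simp [mem_exampleDomain_iff]

lemma isDomainSet_exampleDomain : IsDomainSet exampleDomain := by
  refine ⟨isOpen_exampleDomain, ⟨0, zero_mem_exampleDomain⟩, ?_⟩
  have : StarConvex ℝ (0 : Fin 2 → ℂ) exampleDomain := by
    rw [starConvex_zero_iff]
    intro x hx a ha ha1
    have := balanced_iff_smul_mem.1 balanced_exampleDomain
      (show ‖(a : ℂ)‖ ≤ 1 by simpa [abs_of_nonneg ha] using ha1) hx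
    simpa using this
  exact (this.isPathConnected zero_mem_exampleDomain).isConnected.isPreconnected

lemma not_isBounded_exampleDomain : ¬ Bornology.IsBounded exampleDomain := by
  intro h
  obtain ⟨R, hR⟩ := h.exists_norm_le
  have h1 := hR _ (line_subset_exampleDomain ((|R| + 1 : ℝ) : ℂ))
  have h2 := norm_le_pi_norm (![0, ((|R| + 1 : ℝ) : ℂ)] : Fin 2 → ℂ) 1
  simp only [Matrix.cons_val_one, Matrix.cons_val_fin_one, Complex.norm_real,
    Real.norm_eq_abs] at h2
  rw [abs_of_pos (by positivity)] at h2
  linarith [le_abs_self R]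

lemma isReinhardt_exampleDomain : IsReinhardt exampleDomain := by
  intro z hz ω hω
  refine ⟨by simpa [hω] using hz.1, ?_⟩
  simpa [hω] using hz.2

/-! ### Pseudoconvexity -/

/-- A continuous plurisubharmonic exhaustion function of `exampleDomain`. -/
noncomputable def exhaustion (z : Fin 2 → ℂ) : ℝ :=
  ‖z 1‖ + (1 - ‖z 0‖)⁻¹ + (1 - ‖z 0 ^ 34 * z 1 ^ 55‖)⁻¹

lemma continuousOn_exhaustion : ContinuousOn exhaustion exampleDomain := by
  unfold exhaustion
  refine ContinuousOn.add (ContinuousOn.add (by fun_prop) ?_) ?_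
  · exact ContinuousOn.inv₀ (by fun_prop) fun z hz => (sub_pos.2 hz.1).ne'
  · exact ContinuousOn.inv₀ (by fun_prop) fun z hz => (sub_pos.2 hz.2).ne'

/-- On a complex affine disc each of the three summands is supported from below, with equality at
the centre, by the real part of an entire function; the mean value property does the rest. -/
lemma continuousPlurisubharmonicOn_exhaustion :
    ContinuousPlurisubharmonicOn exhaustion exampleDomain := by
  refine ⟨continuousOn_exhaustion, fun a b hab => ?_⟩
  have hcoord : ∀ i, Differentiable ℂ fun ζ : ℂ => (a + ζ • b) i := fun i => by
    simp only [Pi.add_apply, Pi.smul_apply, smul_eq_mul]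
    fun_prop
  have h0 := hab 0 (by simp)
  obtain ⟨F₁, hF₁, hF₁0, hF₁le⟩ := exists_entire_re_le_norm (hcoord 1)
  obtain ⟨F₂, hF₂, hF₂0, hF₂le⟩ := exists_entire_re_le_inv_one_sub_norm (hcoord 0) h0.1
  obtain ⟨F₃, hF₃, hF₃0, hF₃le⟩ := exists_entire_re_le_inv_one_sub_norm
    (((hcoord 0).pow 34).mul ((hcoord 1).pow 55)) h0.2
  have hv : CircleIntegrable (fun ζ : ℂ => exhaustion (a + ζ • b)) 0 1 := by
    refine ContinuousOn.circleIntegrable zero_le_one ?_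
    refine continuousOn_exhaustion.comp (by fun_prop) fun ζ hζ => hab ζ ?_
    simpa using (mem_sphere_zero_iff_norm.1 hζ).le
  have := le_circleAverage_of_re_le hv ((hF₁.add hF₂).add hF₃) fun ζ hζ => by
    have hζD := hab ζ (mem_sphere_zero_iff_norm.1 hζ).le
    exact add_le_add (add_le_add (hF₁le ζ) (hF₂le ζ hζD.1)) (hF₃le ζ hζD.2)
  refine le_trans (le_of_eq ?_) this
  simp only [Pi.add_apply, Complex.add_re, hF₁0, hF₂0, hF₃0, Pi.mul_apply, Pi.pow_apply]
  simp [exhaustion]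

lemma isPseudoconvex_exampleDomain : IsPseudoconvex exampleDomain := by
  refine ⟨isOpen_exampleDomain, exhaustion, continuousPlurisubharmonicOn_exhaustion, fun c => ?_⟩
  rcases le_or_gt c 0 with hc | hc
  · convert isCompact_empty
    ext z
    simp only [mem_ofPred_eq, mem_empty_iff_false, iff_false, not_and, not_le]
    intro hz
    have h1 : 0 < (1 - ‖z 0‖)⁻¹ := inv_pos.2 (sub_pos.2 hz.1)
    have h2 : 0 < (1 - ‖z 0 ^ 34 * z 1 ^ 55‖)⁻¹ := inv_pos.2 (sub_pos.2 hz.2)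
    have := norm_nonneg (z 1)
    unfold exhaustion
    linarith
  -- All three summands are nonnegative, so `exhaustion z ≤ c` bounds each by `c`. The resulting set
  -- `L` is compact and stays inside the domain.
  set L : Set (Fin 2 → ℂ) :=
    {z | ‖z 0‖ ≤ 1 - c⁻¹ ∧ ‖z 0 ^ 34 * z 1 ^ 55‖ ≤ 1 - c⁻¹ ∧ ‖z 1‖ ≤ c} with hL
  have hcinv : 0 < c⁻¹ := inv_pos.2 hc
  have hLD : L ⊆ exampleDomain := fun z hz => ⟨by linarith [hz.1], by linarith [hz.2.1]⟩
  have hLclosed : IsClosed L := by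
    exact (isClosed_le (f := fun z : Fin 2 → ℂ => ‖z 0‖) (by fun_prop) continuous_const).inter
      ((isClosed_le (f := fun z : Fin 2 → ℂ => ‖z 0 ^ 34 * z 1 ^ 55‖) (by fun_prop)
        continuous_const).inter
      (isClosed_le (f := fun z : Fin 2 → ℂ => ‖z 1‖) (by fun_prop) continuous_const))
  have hLcpt : IsCompact L := by
    refine Metric.isCompact_of_isClosed_isBounded hLclosed ?_
    refine isBounded_iff_forall_norm_le.2 ⟨max 1 c, fun z hz => ?_⟩
    refine (pi_norm_le_iff_of_nonneg (by positivity)).2 fun i => ?_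
    fin_cases i
    · exact le_max_of_le_left (by simpa using (hLD hz).1.le)
    · exact le_max_of_le_right hz.2.2
  have heq : {z | z ∈ exampleDomain ∧ exhaustion z ≤ c} = L ∩ exhaustion ⁻¹' Iic c := by
    ext z
    refine ⟨fun ⟨hz, hzc⟩ => ⟨?_, hzc⟩, fun ⟨hz, hzc⟩ => ⟨hLD hz, hzc⟩⟩
    have h1 : 0 < 1 - ‖z 0‖ := sub_pos.2 hz.1
    have h2 : 0 < 1 - ‖z 0 ^ 34 * z 1 ^ 55‖ := sub_pos.2 hz.2
    have h1' := inv_pos.2 h1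
    have h2' := inv_pos.2 h2
    have h3 := norm_nonneg (z 1)
    unfold exhaustion at hzc
    have e1 := (inv_le_comm₀ h1 hc).1 (by linarith)
    have e2 := (inv_le_comm₀ h2 hc).1 (by linarith)
    exact ⟨by linarith, by linarith, by linarith⟩
  rw [heq]
  exact hLcpt.of_isClosed_subset
    ((continuousOn_exhaustion.mono hLD).preimage_isClosed_of_isClosed hLclosed isClosed_Iic)
    inter_subset_left

/-! ### Minkowski functions and the boundary -/

lemma gauge_exampleDomain (z : Fin 2 → ℂ) :
    gauge exampleDomain z = max ‖z 0‖ ((‖z 0‖ ^ 34 * ‖z 1‖ ^ 55) ^ (89⁻¹ : ℝ)) := by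
  refine gauge_eq_of_forall_inv_smul_mem_iff (by positivity) fun r hr => ?_
  have h : ‖(r⁻¹ • z) 0 ^ 34 * (r⁻¹ • z) 1 ^ 55‖ = (‖z 0‖ ^ 34 * ‖z 1‖ ^ 55) / r ^ 89 := by
    simp only [Pi.smul_apply, norm_mul, norm_pow, norm_smul, Real.norm_eq_abs, abs_inv,
      abs_of_pos hr]
    field_simp
  have h' : ‖(r⁻¹ • z) 0‖ = ‖z 0‖ / r := by
    simp only [Pi.smul_apply, norm_smul, Real.norm_eq_abs, abs_inv, abs_of_pos hr]
    field_simp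
  rw [mem_exampleDomain_iff, h, h', div_lt_one hr, div_lt_one (by positivity), max_lt_iff]
  refine and_congr_right fun _ => ?_
  rw [Real.rpow_inv_lt_iff_of_pos (by positivity) hr.le (by norm_num)]
  norm_cast

lemma continuous_gauge_exampleDomain : Continuous (gauge exampleDomain) := by
  rw [funext gauge_exampleDomain]
  refine Continuous.max (by fun_prop) (Continuous.rpow_const (by fun_prop) fun _ => ?_)
  exact Or.inr (by norm_num)

lemma convexHull_exampleDomain :
    convexHull ℝ exampleDomain = {z : Fin 2 → ℂ | ‖z 0‖ < 1} := by
  apply Subset.antisymm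
  · refine convexHull_min (fun z hz => hz.1) ?_
    have := (convex_ball (0 : ℂ) 1).linear_preimage
      (LinearMap.proj (R := ℝ) (φ := fun _ : Fin 2 => ℂ) 0)
    convert this using 1
    ext z
    simp
  · intro z hz
    obtain ⟨s, hs0, hs1⟩ := exists_between (show ‖z 0‖ < 1 from hz)
    have hs : 0 < s := (norm_nonneg _).trans_lt hs0
    -- With `‖z 0‖ < s < 1`, `z` is the convex combination of `(z 0 / s, 0)` and `(0, z 1 / (1 -
    -- s))` with weights `s` and `1 - s`.
    have h1 : (![z 0 / s, 0] : Fin 2 → ℂ) ∈ exampleDomain := by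
      simp [mem_exampleDomain_iff, abs_of_pos hs, div_lt_one hs, hs0]
    have h2 := line_subset_exampleDomain (z 1 / ((1 - s : ℝ) : ℂ))
    have hc := (convex_convexHull ℝ exampleDomain) (subset_convexHull ℝ _ h1)
      (subset_convexHull ℝ _ h2) hs.le (sub_nonneg.2 hs1.le) (by ring)
    convert hc using 1
    have e1 : (s : ℂ) ≠ 0 := by exact_mod_cast hs.ne'
    have e2 : ((1 - s : ℝ) : ℂ) ≠ 0 := by exact_mod_cast (sub_pos.2 hs1).ne'
    ext i
    fin_cases i
    · simp only [Fin.zero_eta, Pi.add_apply, Pi.smul_apply, Matrix.cons_val_zero,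
        Complex.real_smul]
      field_simp
      simp
    · simp only [Fin.mk_one, Pi.add_apply, Pi.smul_apply, Matrix.cons_val_one,
        Matrix.cons_val_fin_one, Complex.real_smul]
      field_simp
      simp

lemma gauge_convexHull_exampleDomain (z : Fin 2 → ℂ) :
    gauge (convexHull ℝ exampleDomain) z = ‖z 0‖ := by
  rw [convexHull_exampleDomain]
  refine gauge_eq_of_forall_inv_smul_mem_iff (norm_nonneg _) fun r hr => ?_
  rw [mem_ofPred_eq, Pi.smul_apply, norm_smul, norm_inv, Real.norm_eq_abs, abs_of_pos hr,
    inv_mul_lt_one₀ hr]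

/-- Such a point is the limit of `s • z`, `s ↑ 1`, and these lie in the domain by homogeneity. -/
lemma mem_frontier_exampleDomain {z : Fin 2 → ℂ} (h0 : ‖z 0‖ < 1)
    (h1 : ‖z 0 ^ 34 * z 1 ^ 55‖ = 1) : z ∈ frontier exampleDomain := by
  rw [isOpen_exampleDomain.frontier_eq]
  refine ⟨?_, fun h => h.2.ne h1⟩
  have hcont : Tendsto (fun s : ℝ => (s : ℂ) • z) (𝓝[<] 1) (𝓝 z) := by
    have : Continuous fun s : ℝ => (s : ℂ) • z := by fun_prop
    have := this.tendsto 1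
    simp only [Complex.ofReal_one, one_smul] at this
    exact this.mono_left nhdsWithin_le_nhds
  refine mem_closure_of_tendsto hcont ?_
  filter_upwards [Ioo_mem_nhdsLT (zero_lt_one' ℝ)] with s hs
  have hn : ‖(s : ℂ)‖ = s := by simp [abs_of_pos hs.1]
  refine ⟨?_, ?_⟩
  · rw [Pi.smul_apply, smul_eq_mul, norm_mul, hn]
    nlinarith [hs.1, hs.2, norm_nonneg (z 0)]
  · have h : ((s : ℂ) • z) 0 ^ 34 * ((s : ℂ) • z) 1 ^ 55 =
        (s : ℂ) ^ 89 * (z 0 ^ 34 * z 1 ^ 55) := by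
      simp only [Pi.smul_apply, smul_eq_mul]
      ring
    rw [h, norm_mul, norm_pow, hn, h1, mul_one]
    exact pow_lt_one₀ hs.1.le hs.2 (by norm_num)

/-! ### The second Lempert function -/

/-- The Lempert function dominates the Poincaré distance of the first coordinates. -/
lemma artanh_norm_le_add_lempert {p q : Fin 2 → ℂ} (hp : ‖p 0‖ < 1) (hq : ‖q 0‖ < 1) :
    ENNReal.ofReal (Real.artanh ‖q 0‖) ≤
      ENNReal.ofReal (Real.artanh ‖p 0‖) + lempert exampleDomain p q := by
  -- Isolates the infimum, so that each competing disc can be treated separately.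
  rw [← tsub_le_iff_left]
  refine le_iInf₂ fun α hα => ?_
  obtain ⟨hα1, φ, hφ, hm, h0, h1⟩ := hα
  have hα1 : ‖α‖ < 1 := by simpa using hα1
  rw [tsub_le_iff_left, ← ENNReal.ofReal_add (Real.artanh_nonneg (norm_nonneg _))
    (Real.artanh_nonneg (norm_nonneg _))]
  refine ENNReal.ofReal_le_ofReal (artanh_le_add (norm_nonneg _) hp (norm_nonneg _) hα1
    (norm_nonneg _) hq ?_)
  have hd : DifferentiableOn ℂ (fun ζ => φ ζ 0) (ball 0 1) := differentiableOn_pi.1 hφ 0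
  have := norm_mul_one_add_le_of_mapsTo_unitBall hd
    (fun ζ hζ => by simpa using (hm hζ).1) hα1
  rwa [h0, h1] at this

lemma artanh_norm_le_lempertChain_two {q : Fin 2 → ℂ} (hq : ‖q 0‖ < 1) :
    ENNReal.ofReal (Real.artanh ‖q 0‖) ≤ lempertChain 2 exampleDomain 0 q := by
  refine le_lempertChain_two fun p hp => ?_
  have h1 := artanh_norm_le_add_lempert (p := (0 : Fin 2 → ℂ)) (q := p) (by simp) hp.1
  simp only [Pi.zero_apply, norm_zero, Real.artanh_zero, ENNReal.ofReal_zero, zero_add] at h1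
  exact (artanh_norm_le_add_lempert hp.1 hq).trans (by gcongr)

/-- The intermediate point is `(0, q 1)`. The bound `hq1` keeps the horizontal disc `ζ ↦ (ζ, q 1)`
in the domain. -/
lemma lempertChain_two_zero_le {q : Fin 2 → ℂ} (hq : ‖q 0‖ < 1) (hq1 : ‖q 1‖ ≤ 1) :
    lempertChain 2 exampleDomain 0 q ≤ ENNReal.ofReal (Real.artanh ‖q 0‖) := by
  have hm : MapsTo (fun ζ : ℂ => (![ζ, q 1] : Fin 2 → ℂ)) (ball 0 1) exampleDomain := by
    intro ζ hζ
    have hζ : ‖ζ‖ < 1 := by simpa using hζ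
    refine ⟨by simpa using hζ, ?_⟩
    simp only [Matrix.cons_val_zero, Matrix.cons_val_one, Matrix.cons_val_fin_one, norm_mul,
      norm_pow]
    exact (mul_le_of_le_one_right (by positivity) (pow_le_one₀ (norm_nonneg _) hq1)).trans_lt
      (pow_lt_one₀ (norm_nonneg _) hζ (by norm_num))
  have hd : DifferentiableOn ℂ (fun ζ : ℂ => (![ζ, q 1] : Fin 2 → ℂ)) (ball 0 1) := by
    rw [differentiableOn_pi]
    intro i
    fin_cases i
    · exact differentiableOn_id
    · exact differentiableOn_const _
  have hqe : (![q 0, q 1] : Fin 2 → ℂ) = q := by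
    ext i
    fin_cases i <;> rfl
  have h2 := lempert_le hd hm hq
  simp only [hqe] at h2
  have hqD : q ∈ exampleDomain := by
    have := hm (show q 0 ∈ ball (0 : ℂ) 1 by simpa using hq)
    simpa only [hqe] using this
  have h1 : lempert exampleDomain 0 ![0, q 1] = 0 :=
    lempert_zero_eq_zero_of_line fun s => by simpa using line_subset_exampleDomain (s * q 1)
  refine (lempertChain_two_le zero_mem_exampleDomain (line_subset_exampleDomain (q 1)) hqD).trans ?_
  rw [h1, zero_add]
  exact h2

lemma tanhStar_lempertChain_two {q : Fin 2 → ℂ} (hq : ‖q 0‖ < 1) (hq1 : ‖q 1‖ ≤ 1) :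
    tanhStar (lempertChain 2 exampleDomain 0 q) = ‖q 0‖ := by
  rw [le_antisymm (lempertChain_two_zero_le hq hq1) (artanh_norm_le_lempertChain_two hq),
    tanhStar_ofReal_artanh (norm_nonneg _) hq]

/-! ### The Carathéodory lower bound -/

lemma norm_mul_lt_one_of_mem_exampleDomain {z : Fin 2 → ℂ} (hz : z ∈ exampleDomain) :
    ‖z 0 * z 1‖ < 1 := by
  by_contra! h
  have h1 := one_le_pow₀ h (n := 55)
  -- Since `55 = 21 + 34`, both factors are controlled by the defining inequalities.
  have h2 : ‖z 0 * z 1‖ ^ 55 = ‖z 0‖ ^ 21 * ‖z 0 ^ 34 * z 1 ^ 55‖ := by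
    simp only [norm_mul, norm_pow]
    ring
  have h3 : ‖z 0‖ ^ 21 ≤ 1 := pow_le_one₀ (norm_nonneg _) hz.1.le
  rw [h2] at h1
  have := mul_le_of_le_one_left (norm_nonneg (z 0 ^ 34 * z 1 ^ 55)) h3
  linarith [hz.2]

lemma norm_mul_le_tanhStar_caratheodory {q : Fin 2 → ℂ} (hq : ‖q 0 * q 1‖ < 1) :
    ‖q 0 * q 1‖ ≤ tanhStar (caratheodory exampleDomain 0 q) := by
  refine le_tanhStar_of_ofReal_artanh_le hq ?_
  exact le_iSup₂_of_le (fun z : Fin 2 → ℂ => z 0 * z 1)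
    ⟨by fun_prop, fun z hz => by simpa using norm_mul_lt_one_of_mem_exampleDomain hz, by simp⟩
    le_rfl

/-! ### The analytic disc in the boundary -/

lemma norm_exp_lt_two_pow {n : ℕ} (hn : n ≠ 0) {w : ℂ} (hw : ‖w‖ < 1) :
    ‖Complex.exp (n * (w / 2))‖ < 2 ^ n := by
  rw [Complex.exp_nat_mul, norm_pow]
  refine pow_lt_pow_left₀ ?_ (norm_nonneg _) hn
  rw [Complex.norm_exp]
  have h1 : (w / 2).re ≤ 1 / 2 := by
    refine (Complex.re_le_norm _).trans ?_
    rw [norm_div, Complex.norm_ofNat]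
    linarith
  -- Squaring reduces the bound to `e < 4`.
  refine lt_of_pow_lt_pow_left₀ 2 (by norm_num) ?_
  rw [← Real.exp_nat_mul]
  calc Real.exp ((2 : ℕ) * (w / 2).re) ≤ Real.exp 1 := by
        apply Real.exp_le_exp.2
        push_cast
        linarith
    _ < 2 ^ 2 := by linarith [Real.exp_one_lt_d9]

lemma hasNontrivialDiscThrough_frontier_exampleDomain :
    HasNontrivialDiscThrough (frontier exampleDomain) ![(2 ^ 55)⁻¹, 2 ^ 34] := by
  -- The rates `55` and `-34` cancel in `z 0 ^ 34 * z 1 ^ 55`; halving `ζ` keeps the first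
  -- coordinate in the unit disc.
  refine ⟨fun ζ => ![(2 ^ 55)⁻¹ * Complex.exp ((55 : ℕ) * (ζ / 2)),
    2 ^ 34 * Complex.exp (-((34 : ℕ) * (ζ / 2)))], ?_, fun ζ hζ => ?_,
    ⟨0, mem_ball_self one_pos, by simp⟩, 0, mem_ball_self one_pos, 1 / 2, ?_, fun h => ?_⟩
  · rw [differentiableOn_pi]
    intro i
    fin_cases i
    · exact Differentiable.differentiableOn (by
        simp only [Fin.zero_eta, Matrix.cons_val_zero]; fun_prop)
    · exact Differentiable.differentiableOn (by
        simp only [Fin.mk_one, Matrix.cons_val_one, Matrix.cons_val_fin_one]; fun_prop)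
  · have hζ : ‖ζ‖ < 1 := by simpa using hζ
    apply mem_frontier_exampleDomain
    · simp only [Matrix.cons_val_zero, norm_mul, norm_inv, norm_pow, Complex.norm_ofNat]
      rw [inv_mul_lt_one₀ (by positivity)]
      exact norm_exp_lt_two_pow (by norm_num) hζ
    · simp only [Matrix.cons_val_zero, Matrix.cons_val_one, Matrix.cons_val_fin_one]
      rw [mul_pow, mul_pow, ← Complex.exp_nat_mul, ← Complex.exp_nat_mul, mul_mul_mul_comm,
        ← Complex.exp_add]
      have h1 : ((34 : ℕ) : ℂ) * ((55 : ℕ) * (ζ / 2)) + (55 : ℕ) * -((34 : ℕ) * (ζ / 2)) = 0 := by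
        ring
      have h2 : (((2 : ℂ) ^ 55)⁻¹) ^ 34 * (2 ^ 34) ^ 55 = 1 := by
        rw [inv_pow, ← pow_mul, ← pow_mul]
        exact inv_mul_cancel₀ (pow_ne_zero _ two_ne_zero)
      rw [h1, h2]
      simp
  · simp only [mem_ball_zero_iff]
    norm_num
  · have h0 := congrFun h 0
    simp only [Matrix.cons_val_zero] at h0
    have h1 := mul_left_cancel₀ (inv_ne_zero (pow_ne_zero 55 two_ne_zero)) h0
    have h2 := congrArg norm h1
    simp only [Complex.norm_exp] at h2
    have h3 := Real.exp_injective h2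
    norm_num at h3

/-! ### The comparison point and the conclusion -/

/-- The point of `exampleDomain` at which the three functions are compared. -/
noncomputable def examplePoint : Fin 2 → ℂ := ![(2 ^ 89)⁻¹, 1]

lemma norm_examplePoint_zero : ‖examplePoint 0‖ = (2 ^ 89)⁻¹ := by
  simp [examplePoint]

/-- The first coordinate `2⁻⁸⁹` is chosen so that the 89th root is exact. -/
lemma gauge_examplePoint : gauge exampleDomain examplePoint = (2 ^ 34)⁻¹ := by
  have h : ((((2 : ℝ) ^ 89)⁻¹) ^ 34 : ℝ) = (((2 : ℝ) ^ 34)⁻¹) ^ 89 := by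
    rw [inv_pow, inv_pow, ← pow_mul, ← pow_mul]
  have h' : ((((2 : ℝ) ^ 34)⁻¹) ^ 89) ^ (89⁻¹ : ℝ) = (2 ^ 34)⁻¹ := by
    have := Real.pow_rpow_inv_natCast (x := ((2 : ℝ) ^ 34)⁻¹) (by positivity)
      (show 89 ≠ 0 by norm_num)
    exact_mod_cast this
  rw [gauge_exampleDomain, norm_examplePoint_zero, h]
  have h1 : ‖examplePoint 1‖ = 1 := by simp [examplePoint]
  rw [h1, one_pow, mul_one, h']
  norm_num

lemma inv_gauge_smul_examplePoint :
    (gauge exampleDomain examplePoint)⁻¹ • examplePoint = ![(2 ^ 55)⁻¹, 2 ^ 34] := by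
  rw [gauge_examplePoint, inv_inv]
  ext i
  fin_cases i <;> simp [examplePoint]
  norm_num

end Example

end InvariantFunctions

open InvariantFunctions in
/-- The Minkowski function of `D` is Mathlib's `gauge D`, and `gauge (convexHull ℝ D)` is the
Minkowski function of the convex hull of `D`. -/
theorem mainTheorem9 :
    InvariantFunctions.IsDomainSet InvariantFunctions.exampleDomain ∧
    ¬ Bornology.IsBounded InvariantFunctions.exampleDomain ∧
    InvariantFunctions.IsPseudoconvex InvariantFunctions.exampleDomain ∧
    Balanced ℂ InvariantFunctions.exampleDomain ∧
    InvariantFunctions.IsReinhardt InvariantFunctions.exampleDomain ∧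
    Continuous (gauge InvariantFunctions.exampleDomain) ∧
    ∃ a ∈ InvariantFunctions.exampleDomain,
      0 < gauge (convexHull ℝ InvariantFunctions.exampleDomain) a ∧
      InvariantFunctions.HasNontrivialDiscThrough (frontier InvariantFunctions.exampleDomain)
        ((gauge InvariantFunctions.exampleDomain a)⁻¹ • a) ∧
      (∀ t : ℂ, ‖t‖ ≤ 1 →
        InvariantFunctions.tanhStar
            (InvariantFunctions.lempertChain 2 InvariantFunctions.exampleDomain 0 (t • a)) =
          ‖t‖ * gauge (convexHull ℝ InvariantFunctions.exampleDomain) a) ∧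
      (∀ t : ℂ, 1 < ‖t‖ → ‖t‖ < 1 / gauge InvariantFunctions.exampleDomain a →
        ‖t‖ * gauge (convexHull ℝ InvariantFunctions.exampleDomain) a <
          InvariantFunctions.tanhStar
            (InvariantFunctions.caratheodory InvariantFunctions.exampleDomain 0 (t • a))) := by
  have ha0 := norm_examplePoint_zero
  have ha1 : ‖examplePoint 1‖ = 1 := by simp [examplePoint]
  have hsmall : ((2 : ℝ) ^ 89)⁻¹ < 1 := by norm_num
  refine ⟨isDomainSet_exampleDomain, not_isBounded_exampleDomain, isPseudoconvex_exampleDomain,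
    balanced_exampleDomain, isReinhardt_exampleDomain, continuous_gauge_exampleDomain,
    examplePoint, ⟨by rw [ha0]; exact hsmall, ?_⟩, ?_, ?_, fun t ht => ?_, fun t ht1 ht2 => ?_⟩
  · rw [norm_mul, norm_pow, norm_pow, ha0, ha1, one_pow, mul_one]
    exact pow_lt_one₀ (by positivity) hsmall (by norm_num)
  · rw [gauge_convexHull_exampleDomain, ha0]
    positivity
  · rw [inv_gauge_smul_examplePoint]
    exact hasNontrivialDiscThrough_frontier_exampleDomain
  · have h0 : ‖(t • examplePoint) 0‖ = ‖t‖ * ‖examplePoint 0‖ := by simp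
    have h1 : ‖(t • examplePoint) 1‖ = ‖t‖ := by simp [ha1]
    rw [gauge_convexHull_exampleDomain, ← h0]
    refine tanhStar_lempertChain_two ?_ (by rwa [h1])
    rw [h0, ha0]
    exact (mul_le_of_le_one_left (by positivity) ht).trans_lt hsmall
  · have h : ‖(t • examplePoint) 0 * (t • examplePoint) 1‖ = ‖t‖ * (‖t‖ * (2 ^ 89)⁻¹) := by
      simp only [Pi.smul_apply, smul_eq_mul, norm_mul, ha0, ha1]
      ring
    rw [gauge_examplePoint, one_div, inv_inv] at ht2
    rw [gauge_convexHull_exampleDomain, ha0]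
    refine lt_of_lt_of_le ?_ (norm_mul_le_tanhStar_caratheodory ?_)
    · rw [h]
      exact lt_mul_of_one_lt_left (by positivity) ht1
    · rw [h, ← mul_assoc, mul_inv_lt_iff₀ (by positivity), one_mul]
      -- The range of `t` is `‖t‖ < 2 ^ 34`, and `68 ≤ 89` keeps the competitor's value below `1`.
      calc ‖t‖ * ‖t‖ < 2 ^ 34 * 2 ^ 34 := by gcongr
        _ ≤ 2 ^ 89 := by norm_num
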